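/- **Definitions.** A metric space $X$ has *Nagata dimension $\le n$ with constant $\le\gamma$* ($n\in\mathbb N=\{0,1,2,\dots\}$, $0\le\gamma<\infty$) if for every $s>0$ there is a cover $\mathcal B$ of $X$ such that $\operatorname{diam}(B)\le\gamma s$ for every $B\in\mathcal B$, and every $A\subseteq X$ with $\operatorname{diam}(A)<s$ meets at most $n+1$ members of $\mathcal B$. $X$ has *finite Nagata dimension* if this holds for some $n$ and $\gamma$. For metric spaces $(Y,\rho_Y)$, $(Z,\rho_Z)$ and $0\le C<\infty$, a family of maps $\{\varphi^t:Y\to Z\}_{t>0}$ is a *weak $C$-biLipschitz embedding* if for every $t>0$ there is $\sigma_t\in(0,\infty)$ such that for all $x,y\in Y$: $\rho_Z(\varphi^t(x),\varphi^t(y))\le\sigma_t\,\rho_Y(x,y)$; and if $\rho_Y(x,y)\ge Ct$, then $\rho_Z(\varphi^t(x),\varphi^t(y))\ge t\sigma_t$. A *weak biLipschitz embedding* is a weak $C$-biLipschitz embedding for some $C<\infty$. An *$\mathbb R$-tree* is a metric space in which any two distinct points are joined by a unique arc, and this arc is a geodesic. An *$\mathbb R$-star* is, for some set $A$, the wedge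 sum at $0$ of $A$ copies of $[0,\infty)$: the set of $x\in\ell_1(A)$ with nonnegative coordinates at most one of which is nonzero, with the $\ell_1$-metric. **Theorem.** A metric space has finite Nagata dimension if and only if it admits a weak biLipschitz embedding into an $\ell_\infty$-product of finitely many $\mathbb R$-trees. More specifically: 1. For all $n\in\mathbb N$ and $0\le\gamma<\infty$ there is $C<\infty$, depending only on $n$ and $\gamma$, such that every metric space of Nagata dimension $\le n$ with constant $\le\gamma$ admits a weak $C$-biLipschitz embedding into an $\ell_\infty$-product of $n+1$ $\mathbb R$-stars. 2. For all $n\in\mathbb N$ and $0\le C<\infty$ there is $\gamma<\infty$, depending only on $n$ and $C$, such that every metric space that admits a weak $C$-biLipschitz embedding into an $\ell_\infty$-product of $n$ $\mathbb R$-trees has Nagata dimension $\le n$ with constant $\le\gamma$. -/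

import Mathlib

open scoped NNReal ENNReal

universe u v

/-- `X` has Nagata dimension at most `n` with constant at most `γ`: at every scale `s > 0` there is
a cover of `X` by sets of diameter at most `γ * s` such that every set of diameter less than `s`
meets at most `n + 1` members of the cover. Diameters are extended-real valued, so that unbounded
sets have diameter `∞`. -/
def NagataDimLE (X : Type*) [MetricSpace X] (n : ℕ) (γ : ℝ≥0) : Prop :=
  ∀ s : ℝ≥0, 0 < s → ∃ 𝓑 : Set (Set X),
    ⋃₀ 𝓑 = Set.univ ∧
    (∀ B ∈ 𝓑, Metric.ediam B ≤ γ * s) ∧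
    (∀ A : Set X, Metric.ediam A < s → {B ∈ 𝓑 | (B ∩ A).Nonempty}.encard ≤ n + 1)

/-- `X` has finite Nagata dimension. -/
def HasFiniteNagataDim (X : Type*) [MetricSpace X] : Prop :=
  ∃ (n : ℕ) (γ : ℝ≥0), NagataDimLE X n γ

/-- The set `S` is an arc joining the (distinct) points `x` and `y`: the image of an injective
continuous path from `x` to `y`. -/
def IsArcJoining {T : Type*} [MetricSpace T] (S : Set T) (x y : T) : Prop :=
  ∃ f : unitInterval → T, Continuous f ∧ Function.Injective f ∧
    f 0 = x ∧ f 1 = y ∧ Set.range f = S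

/-- The set `S` is a geodesic segment joining `x` and `y`: the image of an isometric embedding of
the interval `[0, d(x, y)]` that maps the end points to `x` and `y`. -/
def IsGeodesicJoining {T : Type*} [MetricSpace T] (S : Set T) (x y : T) : Prop :=
  ∃ f : ℝ → T,
    (∀ a ∈ Set.Icc 0 (dist x y), ∀ b ∈ Set.Icc 0 (dist x y), dist (f a) (f b) = |a - b|) ∧
    f 0 = x ∧ f (dist x y) = y ∧ f '' Set.Icc 0 (dist x y) = S

/-- `T` is an `ℝ`-tree: any two distinct points are joined by a unique arc, and this arc is a
geodesic. -/
def IsRTree (T : Type*) [MetricSpace T] : Prop :=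
  ∀ x y : T, x ≠ y →
    ∃ S : Set T, IsArcJoining S x y ∧ (∀ S' : Set T, IsArcJoining S' x y → S' = S) ∧
      IsGeodesicJoining S x y

/-- The `ℝ`-star with set of branches `A`: the wedge sum of `A` copies of `[0, ∞)` based at `0`,
that is, the set of points of `ℓ₁(A)` with nonnegative coordinates of which at most one is nonzero,
with the metric of `ℓ₁(A)`. -/
abbrev RStar (A : Type*) : Type _ :=
  {x : lp (fun _ : A => ℝ) 1 //
    (∀ a, 0 ≤ x a) ∧ ∀ a b, x a ≠ 0 → x b ≠ 0 → a = b}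

/-- The family of maps `φ t : Y → Z`, `t > 0`, is a weak `C`-biLipschitz embedding; `σ` is the
scaling factor at scale `t`. (The values of `φ` at `t ≤ 0` play no role.) -/
def IsWeakBiLipschitzEmbedding {Y Z : Type*} [MetricSpace Y] [MetricSpace Z] (C : ℝ≥0)
    (φ : ℝ → Y → Z) : Prop :=
  ∀ t : ℝ, 0 < t → ∃ σ : ℝ, 0 < σ ∧
    (∀ x y : Y, dist (φ t x) (φ t y) ≤ σ * dist x y) ∧
    (∀ x y : Y, C * t ≤ dist x y → t * σ ≤ dist (φ t x) (φ t y))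

/-- `Y` admits a weak `C`-biLipschitz embedding into `Z`. -/
def WeaklyEmbeds (Y Z : Type*) [MetricSpace Y] [MetricSpace Z] (C : ℝ≥0) : Prop :=
  ∃ φ : ℝ → Y → Z, IsWeakBiLipschitzEmbedding C φ

/-! From dimension to stars: take a cover of bounded multiplicity and compare the heights `r - d(x,
B)` of its members at `x`. For a finite set `F` of members, let `U F` be the points where the
heights in `F` are at least `δ` and exceed all others by `δ`. Pigeonhole puts each point in some `U
F` with `1 ≤ |F| ≤ n + 1`. For distinct `F`, `F'` of equal size, neither contains the other, so two
heights must swap order between `U F` and `U F'`, which keeps these sets apart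
(`NagataDimLE.exists_separated_families`). Each cardinality thus gives one separated family, and the
height over its sets is a 1-Lipschitz map to a star (`exists_map_rStar`).

From trees to dimension: cut a rooted tree into annuli of width `δ`. Discarding the annuli of one
residue class mod `n + 1` leaves separated blocks of `n` annuli; inside a block, points are grouped
by where their geodesics from the root pass just below it (`IsRTree.exists_labelings`). In a product
of `n` trees each factor excludes at most one of the `n + 1` classes, so some class serves all
coordinates. Pulling the joint labels back yields the cover.

The equivalence also needs that stars are trees, shown by cut points. -/

open Set Metric

/-! ### Separated families from covers of bounded multiplicity -/

/-- A real function whose positive part lives on a finite set of at most `n + 1` points and that is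
at least `(n + 1) * δ` somewhere has a superlevel set separated from its complement by a gap
of size `δ`. -/
theorem exists_finset_gap {ι : Type*} {n : ℕ} {δ : ℝ} (hδ : 0 < δ) (v : ι → ℝ) (P : Finset ι)
    (hP : P.card ≤ n + 1) {i₀ : ι} (hi₀ : i₀ ∈ P) (hv : (n + 1) * δ ≤ v i₀) :
    ∃ F ⊆ P, F.Nonempty ∧ (∀ i ∈ F, δ ≤ v i) ∧
      ∀ i ∈ F, ∀ j, j ∉ F → (j ∈ P ∨ v j ≤ 0) → v j + δ ≤ v i := by
  classical
  -- At most `n` points besides `i₀` meet the `n + 1` bins `[mδ, (m + 1)δ)` with `m ≤ n`, so some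
  -- bin is empty; `i₀` lies above all of them.
  have hcard : ((P.erase i₀).image fun i => ⌊v i / δ⌋₊).card < (Finset.range (n + 1)).card := by
    refine Finset.card_image_le.trans_lt ?_
    rw [Finset.card_erase_of_mem hi₀, Finset.card_range]
    omega
  obtain ⟨m, hm, hmP⟩ := Finset.exists_mem_notMem_of_card_lt_card hcard
  have hmn : (m : ℝ) ≤ n := by
    exact_mod_cast Nat.lt_succ_iff.1 (Finset.mem_range.1 hm)
  have h0 : (m + 1 : ℝ) * δ ≤ v i₀ := le_trans (by gcongr) hv
  have hmδ : 0 ≤ (m : ℝ) * δ := by positivity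
  refine ⟨P.filter fun i => (m + 1 : ℝ) * δ ≤ v i, Finset.filter_subset _ _,
    ⟨i₀, Finset.mem_filter.2 ⟨hi₀, h0⟩⟩, fun i hi => ?_, fun i hi j hj hj' => ?_⟩
  · have := (Finset.mem_filter.1 hi).2
    linarith
  · have hi' := (Finset.mem_filter.1 hi).2
    suffices v j ≤ m * δ by linarith
    rcases hj' with hj' | hj'
    · have hlt : v j < (m + 1 : ℝ) * δ := by
        by_contra! h
        exact hj (Finset.mem_filter.2 ⟨hj', h⟩)
      by_contra! h
      refine hmP (Finset.mem_image.2 ⟨j, Finset.mem_erase.2 ⟨?_, hj'⟩, ?_⟩)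
      · rintro rfl
        linarith
      · have hpos : 0 ≤ v j / δ := div_nonneg (by linarith) hδ.le
        rw [Nat.floor_eq_iff hpos]
        exact ⟨(le_div_iff₀ hδ).2 h.le, (div_lt_iff₀ hδ).2 hlt⟩
    · linarith

/-- A space of Nagata dimension at most `n` is covered by `n + 1` families of bounded sets, each of
which is separated. -/
theorem NagataDimLE.exists_separated_families {X : Type*} [MetricSpace X] {n : ℕ} {γ : ℝ≥0}
    (h : NagataDimLE X n γ) {δ : ℝ} (hδ : 0 < δ) :
    ∃ 𝓕 : Fin (n + 1) → Set (Set X),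
      (∀ x, ∃ k, ∃ U ∈ 𝓕 k, x ∈ U) ∧
      (∀ k, ∀ U ∈ 𝓕 k, ∀ x ∈ U, ∀ y ∈ U, dist x y ≤ (γ + 1) * (4 * ((n + 1) * δ))) ∧
      ∀ k, ∀ U ∈ 𝓕 k, ∀ V ∈ 𝓕 k, U ≠ V → ∀ x ∈ U, ∀ y ∈ V, δ ≤ dist x y := by
  classical
  obtain ⟨r, hr⟩ : ∃ r : ℝ, r = (n + 1) * δ := ⟨_, rfl⟩
  have hr0 : 0 < r := by rw [hr]; positivity
  have hδr : δ ≤ r := by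
    rw [hr]
    nlinarith [(Nat.cast_nonneg n : (0 : ℝ) ≤ n)]
  rw [← hr]
  obtain ⟨𝓑, hcov, hdiam, hmult⟩ := h (Real.toNNReal (4 * r)) (by simpa using hr0)
  have hbdd : ∀ B ∈ 𝓑, ∀ x ∈ B, ∀ y ∈ B, dist x y ≤ γ * (4 * r) := by
    intro B hB x hx y hy
    have h1 := (edist_le_ediam_of_mem hx hy).trans (hdiam B hB)
    rw [← ENNReal.coe_mul, edist_nndist, ENNReal.coe_le_coe, ← NNReal.coe_le_coe] at h1
    simpa [Real.coe_toNNReal _ (by positivity : (0 : ℝ) ≤ 4 * r)] using h1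
  let v : Set X → X → ℝ := fun B x => r - infDist x B
  have hv : ∀ B x y, v B x - v B y ≤ dist x y := by
    intro B x y
    have := infDist_le_infDist_add_dist (s := B) (x := y) (y := x)
    rw [dist_comm] at this
    simp only [v]
    linarith
  -- `infDist x ∅ = 0` would give the empty set the maximal height `r`.
  let 𝓑' : Set (Set X) := {B ∈ 𝓑 | B.Nonempty}
  let U : Finset (Set X) → Set X := fun F =>
    {x | (∀ B ∈ F, δ ≤ v B x) ∧ ∀ B ∈ F, ∀ B' ∈ 𝓑', B' ∉ F → v B' x + δ ≤ v B x}
  refine ⟨fun k => {W | ∃ F : Finset (Set X), ↑F ⊆ 𝓑' ∧ F.card = k + 1 ∧ U F = W}, ?_, ?_, ?_⟩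
  · intro x
    -- Only members meeting this ball can have positive height at `x`.
    have hm := hmult (closedBall x r) (by
      refine (ediam_le (d := ENNReal.ofReal (2 * r)) fun y hy z hz => ?_).trans_lt ?_
      · rw [edist_dist]
        refine ENNReal.ofReal_le_ofReal ?_
        have := dist_triangle_right y z x
        rw [mem_closedBall] at hy hz
        linarith
      · exact (ENNReal.ofReal_lt_ofReal_iff (by linarith)).2 (by linarith))
    have hfin : {B ∈ 𝓑 | (B ∩ closedBall x r).Nonempty}.Finite := by
      rw [← Set.encard_lt_top_iff]
      exact hm.trans_lt (by exact_mod_cast ENat.natCast_lt_top (n + 1))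
    have hPc : hfin.toFinset.card ≤ n + 1 := by
      rw [hfin.encard_eq_coe_toFinset_card] at hm
      exact_mod_cast hm
    obtain ⟨B₀, hB₀, hx⟩ : ∃ B ∈ 𝓑, x ∈ B := by
      have : x ∈ ⋃₀ 𝓑 := hcov ▸ mem_univ x
      simpa using this
    obtain ⟨F, hFP, hne, hF1, hF2⟩ := exists_finset_gap hδ (fun B => v B x) hfin.toFinset hPc
      (i₀ := B₀) (by simpa using ⟨hB₀, x, hx, mem_closedBall_self hr0.le⟩)
      (by simp [v, infDist_zero_of_mem hx, hr])
    have hcard := (Finset.card_le_card hFP).trans hPc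
    have hpos := hne.card_pos
    refine ⟨⟨F.card - 1, by omega⟩, U F, ⟨F, fun B hB => ?_, by simp; omega, rfl⟩, hF1, ?_⟩
    · have hB' : B ∈ 𝓑 ∧ (B ∩ closedBall x r).Nonempty := by simpa using hFP hB
      exact ⟨hB'.1, hB'.2.mono inter_subset_left⟩
    · intro B hB B' hB' hB'F
      refine hF2 B hB B' hB'F ?_
      by_cases hP : (B' ∩ closedBall x r).Nonempty
      · exact Or.inl (by simpa using ⟨hB'.1, hP⟩)
      · right
        have : r ≤ infDist x B' := by
          by_contra! hlt
          obtain ⟨y, hy, hxy⟩ := (infDist_lt_iff hB'.2).1 hlt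
          exact hP ⟨y, hy, by rw [mem_closedBall, dist_comm]; exact hxy.le⟩
        simp only [v]
        linarith
  · rintro k _ ⟨F, hF, hc, rfl⟩ x hx y hy
    obtain ⟨B, hB⟩ : F.Nonempty := Finset.card_pos.1 (by omega)
    have key : ∀ z ∈ U F, ∃ b ∈ B, dist z b < r := fun z hz => by
      refine (infDist_lt_iff (hF hB).2).1 ?_
      have := hz.1 B hB
      simp only [v] at this
      linarith
    obtain ⟨a, ha, hxa⟩ := key x hx
    obtain ⟨b, hb, hyb⟩ := key y hy
    have h1 := hbdd B (hF hB).1 a ha b hb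
    have h2 := dist_triangle4 x a b y
    rw [dist_comm b y] at h2
    linarith
  · rintro k _ ⟨F, hF, hc, rfl⟩ _ ⟨F', hF', hc', rfl⟩ hne x hx y hy
    have hFF' : F ≠ F' := fun h => hne (h ▸ rfl)
    obtain ⟨B, hB, hB'⟩ : ∃ B ∈ F, B ∉ F' := by
      by_contra! hsub
      exact hFF' (Finset.eq_of_subset_of_card_le hsub (by omega))
    obtain ⟨D, hD, hD'⟩ : ∃ D ∈ F', D ∉ F := by
      by_contra! hsub
      exact hFF' (Finset.eq_of_subset_of_card_le hsub (by omega)).symm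
    -- The height of `B` minus that of `D` is at least `δ` at `x` and at most `-δ` at `y`, while it
    -- is 2-Lipschitz.
    have h1 := hx.2 B hB D (hF' hD) hD'
    have h2 := hy.2 D hD B (hF hB) hB'
    have h3 := hv B x y
    have h4 := hv D y x
    rw [dist_comm] at h4
    linarith

/-! ### The metric of an `ℝ`-star -/

namespace RStar

variable {A : Type*}

open Classical in
/-- The point at distance `r` from the base point on the branch `a`; the base point if `r ≤ 0`. -/
noncomputable def mk (a : A) (r : ℝ) : RStar A :=
  ⟨lp.single 1 a (max r 0), by
    refine ⟨fun b => ?_, fun b c hb hc => ?_⟩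
    · rw [lp.single_apply, Pi.single_apply]
      split_ifs <;> simp
    · rw [lp.single_apply, Pi.single_apply] at hb hc
      rw [(ite_ne_right_iff.1 hb).1, (ite_ne_right_iff.1 hc).1]⟩

theorem mk_apply_self (a : A) (r : ℝ) : (mk a r).1 a = max r 0 := by
  simp [mk]

theorem mk_apply_of_ne {a b : A} (h : b ≠ a) (r : ℝ) : (mk a r).1 b = 0 := by
  simp [mk, h]

theorem mk_of_nonpos (a b : A) {r s : ℝ} (hr : r ≤ 0) (hs : s ≤ 0) : mk a r = mk b s := by
  apply Subtype.ext
  simp [mk, hr, hs]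

theorem dist_mk_self (a : A) (r s : ℝ) : dist (mk a r) (mk a s) = |max r 0 - max s 0| := by
  classical
  rw [Subtype.dist_eq, dist_eq_norm]
  simp only [mk]
  rw [← lp.single_sub, lp.norm_single one_pos, Real.norm_eq_abs]

theorem dist_mk_of_ne {a b : A} (h : a ≠ b) (r s : ℝ) :
    dist (mk a r) (mk b s) = max r 0 + max s 0 := by
  classical
  rw [Subtype.dist_eq, dist_eq_norm]
  have := lp.norm_sum_single (E := fun _ : A => ℝ) (p := 1) (by simp)
    (fun c => if c = a then max r 0 else - max s 0) {a, b}
  rw [Finset.sum_pair h, Finset.sum_pair h] at this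
  simp only [if_true, if_neg h.symm, lp.single_neg, ENNReal.toReal_one, Real.rpow_one, norm_neg,
    ← sub_eq_add_neg] at this
  simp only [mk]
  rw [this, Real.norm_of_nonneg (le_max_right _ _), Real.norm_of_nonneg (le_max_right _ _)]

theorem eq_mk {x : RStar A} {a : A} (h : ∀ b, b ≠ a → x.1 b = 0) : x = mk a (x.1 a) := by
  apply Subtype.ext
  ext b
  by_cases hb : b = a
  · subst hb
    rw [mk_apply_self, max_eq_left (x.2.1 b)]
  · rw [mk_apply_of_ne hb, h b hb]

theorem exists_eq_mk [Nonempty A] (x : RStar A) : ∃ a r, 0 ≤ r ∧ x = mk a r := by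
  by_cases h : ∃ a, x.1 a ≠ 0
  · obtain ⟨a, ha⟩ := h
    refine ⟨a, x.1 a, x.2.1 a, eq_mk fun b hb => ?_⟩
    by_contra hb0
    exact hb (x.2.2 b a hb0 ha)
  · push Not at h
    exact ⟨Classical.arbitrary A, _, le_of_eq (h _).symm, eq_mk fun b _ => h b⟩

theorem abs_apply_sub_le (x y : RStar A) (a : A) : |x.1 a - y.1 a| ≤ dist x y := by
  rw [Subtype.dist_eq, dist_eq_norm]
  exact lp.norm_apply_le_norm one_ne_zero (x.1 - y.1) a

end RStar

/-! ### Weak embeddings into products of stars -/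

/-- The map to an `ℝ`-star associated with a separated family of sets. -/
theorem exists_map_rStar {X : Type*} [MetricSpace X] (𝓕 : Set (Set X)) {t : ℝ} (ht : 0 < t)
    (hsep : ∀ U ∈ 𝓕, ∀ V ∈ 𝓕, U ≠ V → ∀ x ∈ U, ∀ y ∈ V, 2 * t ≤ dist x y) :
    ∃ f : X → RStar (Set X), (∀ x y, dist (f x) (f y) ≤ dist x y) ∧
      ∀ U ∈ 𝓕, ∀ x ∈ U, ∀ y, t ≤ infDist y U → t ≤ dist (f x) (f y) := by
  classical
  have hsep' : ∀ U ∈ 𝓕, ∀ V ∈ 𝓕, U ≠ V → U.Nonempty → V.Nonempty → ∀ x y,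
      (t - infDist x U) + (t - infDist y V) ≤ dist x y := by
    intro U hU V hV hne hUn hVn x y
    refine le_of_forall_pos_le_add fun ε hε => ?_
    obtain ⟨a, ha, hxa⟩ := (infDist_lt_iff hUn).1 (lt_add_of_pos_right (infDist x U) (half_pos hε))
    obtain ⟨b, hb, hyb⟩ := (infDist_lt_iff hVn).1 (lt_add_of_pos_right (infDist y V) (half_pos hε))
    have h1 := hsep U hU V hV hne a ha b hb
    have h2 := dist_triangle4 a x y b
    rw [dist_comm a x] at h2
    linarith
  -- The open `t`-neighbourhoods of the sets are disjoint, so `x` has at most one branch `U`, with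
  -- height `r`; outside all of them `r = 0` and the branch is immaterial.
  have hex : ∀ x, ∃ U : Set X, ∃ r : ℝ, (U ∈ 𝓕 ∧ U.Nonempty ∧ r = t - infDist x U ∨ r = 0) ∧
      0 ≤ r ∧ ∀ V ∈ 𝓕, V.Nonempty → infDist x V < t → V = U ∧ r = t - infDist x V := by
    intro x
    by_cases h : ∃ U ∈ 𝓕, U.Nonempty ∧ infDist x U < t
    · obtain ⟨U, hU, hUn, hxU⟩ := h
      refine ⟨U, t - infDist x U, Or.inl ⟨hU, hUn, rfl⟩, by linarith, fun V hV hVn hxV => ?_⟩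
      have hVU : V = U := by
        by_contra hne
        have := hsep' V hV U hU hne hVn hUn x x
        rw [dist_self] at this
        linarith
      exact ⟨hVU, by rw [hVU]⟩
    · push Not at h
      refine ⟨∅, 0, Or.inr rfl, le_rfl, fun V hV hVn hxV => ?_⟩
      exact absurd hxV (not_lt.2 (h V hV hVn))
  choose U r hUr hr0 hmax using hex
  -- The right side is the `V`-coordinate of the image of `x`.
  have hlow : ∀ x, ∀ V ∈ 𝓕, V.Nonempty → t - infDist x V ≤ if V = U x then r x else 0 := by
    intro x V hV hVn
    by_cases hlt : infDist x V < t
    · obtain ⟨h1, h2⟩ := hmax x V hV hVn hlt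
      rw [if_pos h1, h2]
    · split_ifs
      · linarith [hr0 x]
      · linarith
  have hone : ∀ x y, U x = U y → r x - r y ≤ dist x y := by
    intro x y hxy
    rcases hUr x with ⟨hU, hUn, hx⟩ | hx
    · have h1 := hlow y (U x) hU hUn
      rw [if_pos hxy] at h1
      have h2 := infDist_le_infDist_add_dist (s := U x) (x := y) (y := x)
      rw [dist_comm] at h2
      linarith
    · linarith [hr0 y, dist_nonneg (x := x) (y := y)]
  have htwo : ∀ x y, U x ≠ U y → r y = 0 → r x ≤ dist x y := by
    intro x y hxy hy
    rcases hUr x with ⟨hU, hUn, hx⟩ | hx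
    · have h1 := hlow y (U x) hU hUn
      rw [if_neg hxy] at h1
      have h2 := infDist_le_infDist_add_dist (s := U x) (x := y) (y := x)
      rw [dist_comm] at h2
      linarith
    · linarith [dist_nonneg (x := x) (y := y)]
  refine ⟨fun x => RStar.mk (U x) (r x), fun x y => ?_, fun V hV x hx y hy => ?_⟩
  · change dist (RStar.mk (U x) (r x)) (RStar.mk (U y) (r y)) ≤ dist x y
    by_cases hxy : U x = U y
    · rw [← hxy, RStar.dist_mk_self, max_eq_left (hr0 x), max_eq_left (hr0 y), abs_le]
      have := hone y x hxy.symm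
      rw [dist_comm] at this
      exact ⟨by linarith, hone x y hxy⟩
    · rw [RStar.dist_mk_of_ne hxy, max_eq_left (hr0 x), max_eq_left (hr0 y)]
      rcases hUr x with ⟨hU, hUn, h1⟩ | h1
      · rcases hUr y with ⟨hU', hUn', h2⟩ | h2
        · rw [h1, h2]
          exact hsep' _ hU _ hU' hxy hUn hUn' x y
        · linarith [htwo x y hxy h2]
      · have := htwo y x (Ne.symm hxy) h1
        rw [dist_comm] at this
        linarith
  · have hVn : V.Nonempty := ⟨x, hx⟩
    obtain ⟨h1, h2⟩ := hmax x V hV hVn (by rwa [infDist_zero_of_mem hx])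
    rw [infDist_zero_of_mem hx, sub_zero] at h2
    refine le_trans ?_ (RStar.abs_apply_sub_le _ _ V)
    have hx' : (RStar.mk (U x) (r x)).1 V = t := by
      rw [h1, RStar.mk_apply_self, h2, max_eq_left ht.le]
    have hy' : (RStar.mk (U y) (r y)).1 V = 0 := by
      by_cases hVU : V = U y
      · have hry : r y ≤ 0 := by
          rcases hUr y with ⟨-, -, h3⟩ | h3
          · rw [← hVU] at h3
            linarith
          · exact h3.le
        rw [hVU, RStar.mk_apply_self, max_eq_right hry]
      · exact RStar.mk_apply_of_ne hVU _
    rw [hx', hy', sub_zero]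
    exact le_abs_self t

/-- Spaces of Nagata dimension at most `n` embed weakly into products of `n + 1` stars. -/
theorem NagataDimLE.weaklyEmbeds {X : Type u} [MetricSpace X] {n : ℕ} {γ : ℝ≥0}
    (h : NagataDimLE X n γ) :
    WeaklyEmbeds X (∀ _ : Fin (n + 1), RStar (Set X)) (8 * (γ + 1) * (n + 1) + 1) := by
  have key : ∀ t : ℝ, ∃ f : X → ∀ _ : Fin (n + 1), RStar (Set X), 0 < t →
      (∀ x y, dist (f x) (f y) ≤ dist x y) ∧
      ∀ x y, (8 * (γ + 1) * (n + 1) + 1) * t ≤ dist x y → t ≤ dist (f x) (f y) := by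
    intro t
    by_cases ht : 0 < t
    · obtain ⟨𝓕, hcov, hbdd, hsep⟩ := h.exists_separated_families (mul_pos two_pos ht)
      choose f hf1 hf2 using fun k => exists_map_rStar (𝓕 k) ht (hsep k)
      refine ⟨fun x k => f k x, fun _ => ⟨fun x y => ?_, fun x y hxy => ?_⟩⟩
      · exact (dist_pi_le_iff dist_nonneg).2 fun k => hf1 k x y
      · obtain ⟨k, U, hU, hx⟩ := hcov x
        refine (hf2 k U hU x hx y ?_).trans (dist_le_pi_dist (fun k => f k x) (fun k => f k y) k)
        by_contra! hlt
        obtain ⟨z, hz, hyz⟩ := (infDist_lt_iff ⟨x, hx⟩).1 hlt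
        have h1 := hbdd k U hU x hx z hz
        have h2 := dist_triangle_right x y z
        linarith
    · exact ⟨fun _ _ => RStar.mk ∅ 0, fun h => absurd h ht⟩
  choose φ hφ using key
  refine ⟨φ, fun t ht => ⟨1, one_pos, fun x y => ?_, fun x y hxy => ?_⟩⟩
  · rw [one_mul]
    exact (hφ t ht).1 x y
  · rw [mul_one]
    exact (hφ t ht).2 x y (by simpa using hxy)

/-! ### Covers from labelings -/

/-- Suppose that at each scale `s` there are `n + 1` partially defined labelings whose domains cover
`X`, such that points with the same label are at distance at most `γ * s` and points with different
labels are at distance at least `s`. Then `X` has Nagata dimension at most `n`. -/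
theorem nagataDimLE_of_labelings {X : Type*} [MetricSpace X] {n : ℕ} {γ : ℝ≥0}
    {L : Type*}
    (h : ∀ s : ℝ, 0 < s → ∃ (D : Fin (n + 1) → Set X) (l : Fin (n + 1) → X → L),
      (∀ x, ∃ k, x ∈ D k) ∧
      (∀ k, ∀ x ∈ D k, ∀ y ∈ D k, l k x = l k y → dist x y ≤ γ * s) ∧
      ∀ k, ∀ x ∈ D k, ∀ y ∈ D k, l k x ≠ l k y → s ≤ dist x y) :
    NagataDimLE X n γ := by
  classical
  intro s hs
  obtain ⟨D, l, hcov, hbdd, hsep⟩ := h s hs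
  let B : Fin (n + 1) → X → Set X := fun k x => {y ∈ D k | l k y = l k x}
  refine ⟨{W | ∃ k, ∃ x ∈ D k, W = B k x}, ?_, ?_, fun A hA => ?_⟩
  · refine eq_univ_of_forall fun x => ?_
    obtain ⟨k, hk⟩ := hcov x
    exact ⟨B k x, ⟨k, x, hk, rfl⟩, hk, rfl⟩
  · rintro _ ⟨k, x, hx, rfl⟩
    refine ediam_le fun y hy z hz => ?_
    have := hbdd k y hy.1 z hz.1 (hy.2.trans hz.2.symm)
    rw [← ENNReal.coe_mul, edist_nndist, ENNReal.coe_le_coe, ← NNReal.coe_le_coe]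
    simpa using this
  -- A set of diameter less than `s` meets at most one fiber of each labeling; `g k` is that fiber.
  · let g : Fin (n + 1) → Set X := fun k =>
      if h : ∃ x ∈ D k, x ∈ A then B k h.choose else ∅
    have hsub : {W ∈ {W | ∃ k, ∃ x ∈ D k, W = B k x} | (W ∩ A).Nonempty} ⊆ g '' univ := by
      rintro _ ⟨⟨k, x, hx, rfl⟩, y, hy, hyA⟩
      have hex : ∃ x ∈ D k, x ∈ A := ⟨y, hy.1, hyA⟩
      refine ⟨k, mem_univ k, ?_⟩
      simp only [g, dif_pos hex]
      obtain ⟨hz, hzA⟩ := hex.choose_spec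
      have hl : l k hex.choose = l k x := by
        rw [← hy.2]
        by_contra hne
        have h1 := hsep k _ hz y hy.1 hne
        have h2 := (edist_le_ediam_of_mem hzA hyA).trans_lt hA
        rw [edist_nndist, ENNReal.coe_lt_coe, ← NNReal.coe_lt_coe, coe_nndist] at h2
        linarith
      simp only [B, hl]
    refine (encard_le_encard hsub).trans ((encard_image_le _ _).trans ?_)
    simp

/-! ### Geodesics and branching in `ℝ`-trees -/

theorem isArcJoining_image_Icc {T : Type*} [MetricSpace T] {f : ℝ → T} {L : ℝ} (hL : 0 < L)
    (hf : ContinuousOn f (Icc 0 L)) (hinj : InjOn f (Icc 0 L)) :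
    IsArcJoining (f '' Icc 0 L) (f 0) (f L) := by
  have hmem : ∀ t : unitInterval, L * t ∈ Icc 0 L := fun t =>
    ⟨mul_nonneg hL.le t.2.1, mul_le_of_le_one_right hL.le t.2.2⟩
  refine ⟨fun t => f (L * t), hf.comp_continuous (by fun_prop) hmem, fun a b hab => ?_,
    by simp, by simp, ?_⟩
  · exact Subtype.ext (mul_left_cancel₀ hL.ne' (hinj (hmem a) (hmem b) hab))
  · ext x
    constructor
    · rintro ⟨t, rfl⟩
      exact ⟨_, hmem t, rfl⟩
    · rintro ⟨t, ht, rfl⟩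
      refine ⟨⟨t / L, div_nonneg ht.1 hL.le, div_le_one_of_le₀ ht.2 hL.le⟩, ?_⟩
      simp only
      rw [mul_div_cancel₀ _ hL.ne']

/-- `c` is a parametrized geodesic of length `dist x y` from `x` to `y`. -/
def IsGeodesicPath {T : Type*} [MetricSpace T] (c : ℝ → T) (x y : T) : Prop :=
  (∀ a ∈ Icc 0 (dist x y), ∀ b ∈ Icc 0 (dist x y), dist (c a) (c b) = |a - b|) ∧
    c 0 = x ∧ c (dist x y) = y

namespace IsGeodesicPath

variable {T : Type*} [MetricSpace T] {c : ℝ → T} {x y : T}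

theorem continuousOn (h : IsGeodesicPath c x y) : ContinuousOn c (Icc 0 (dist x y)) := by
  refine (LipschitzOnWith.of_dist_le_mul (K := 1) fun a ha b hb => ?_).continuousOn
  rw [h.1 a ha b hb, Real.dist_eq, NNReal.coe_one, one_mul]

theorem injOn (h : IsGeodesicPath c x y) : InjOn c (Icc 0 (dist x y)) := by
  intro a ha b hb hab
  have := h.1 a ha b hb
  rw [hab, dist_self] at this
  exact sub_eq_zero.1 (abs_eq_zero.1 this.symm)

theorem dist_left (h : IsGeodesicPath c x y) {t : ℝ} (ht : t ∈ Icc 0 (dist x y)) :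
    dist x (c t) = t := by
  rw [← h.2.1, h.1 0 ⟨le_rfl, dist_nonneg⟩ t ht, zero_sub, abs_neg, abs_of_nonneg ht.1]

theorem dist_right (h : IsGeodesicPath c x y) {t : ℝ} (ht : t ∈ Icc 0 (dist x y)) :
    dist (c t) y = dist x y - t := by
  conv_lhs => rw [← h.2.2]
  rw [h.1 t ht _ ⟨dist_nonneg, le_rfl⟩, abs_sub_comm, abs_of_nonneg (sub_nonneg.2 ht.2)]

end IsGeodesicPath

namespace IsRTree

variable {T : Type*} [MetricSpace T]

theorem exists_isGeodesicPath (hT : IsRTree T) (x y : T) : ∃ c, IsGeodesicPath c x y := by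
  rcases eq_or_ne x y with rfl | hxy
  · refine ⟨fun _ => x, fun a ha b hb => ?_, rfl, rfl⟩
    rw [dist_self, Icc_self, mem_singleton_iff] at ha hb
    simp [ha, hb]
  · obtain ⟨S, -, -, f, h1, h2, h3, -⟩ := hT x y hxy
    exact ⟨f, h1, h2, h3⟩

/-- Two geodesics issuing from the same point agree up to any common point. -/
theorem eq_of_eq (hT : IsRTree T) {p x y : T} {c d : ℝ → T} (hc : IsGeodesicPath c p x)
    (hd : IsGeodesicPath d p y) {m : ℝ} (hm : 0 ≤ m) (hmx : m ≤ dist p x) (hmy : m ≤ dist p y)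
    (hcd : c m = d m) {t : ℝ} (ht : 0 ≤ t) (htm : t ≤ m) : c t = d t := by
  rcases hm.eq_or_lt with rfl | hm
  · rwa [le_antisymm htm ht]
  have hx : Icc 0 m ⊆ Icc 0 (dist p x) := Icc_subset_Icc_right hmx
  have hy : Icc 0 m ⊆ Icc 0 (dist p y) := Icc_subset_Icc_right hmy
  have h1 := isArcJoining_image_Icc hm (hc.continuousOn.mono hx) (hc.injOn.mono hx)
  have h2 := isArcJoining_image_Icc hm (hd.continuousOn.mono hy) (hd.injOn.mono hy)
  rw [hc.2.1] at h1
  rw [hd.2.1, ← hcd] at h2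
  have hne : p ≠ c m := by
    intro h
    have := hc.dist_left ⟨hm.le, hmx⟩
    rw [← h, dist_self] at this
    exact hm.ne this
  obtain ⟨S, -, hS, -⟩ := hT p (c m) hne
  have himg : c '' Icc 0 m = d '' Icc 0 m := (hS _ h1).trans (hS _ h2).symm
  obtain ⟨t', ht', h⟩ : c t ∈ d '' Icc 0 m := himg ▸ mem_image_of_mem c ⟨ht, htm⟩
  -- The distance to `p` recovers the parameter, so equal images force equal parametrizations.
  have h3 := hd.dist_left (hy ht')
  rw [h, hc.dist_left (hx ⟨ht, htm⟩)] at h3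
  rw [← h, h3]

/-- In an `ℝ`-tree, geodesics that issue from `p` and are apart at distance `τ` from `p` do not come
close again. -/
theorem le_dist_of_ne (hT : IsRTree T) {p x y : T} {c d : ℝ → T} (hc : IsGeodesicPath c p x)
    (hd : IsGeodesicPath d p y) {τ : ℝ} (hτ : 0 ≤ τ) (hτx : τ ≤ dist p x) (hτy : τ ≤ dist p y)
    (hne : c τ ≠ d τ) : (dist p x - τ) + (dist p y - τ) ≤ dist x y := by
  have hcx : Icc 0 τ ⊆ Icc 0 (dist p x) := Icc_subset_Icc_right hτx
  have hdy : Icc 0 τ ⊆ Icc 0 (dist p y) := Icc_subset_Icc_right hτy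
  let E : Set ℝ := {t ∈ Icc 0 τ | dist (c t) (d t) ∈ ({0} : Set ℝ)}
  have hEc : IsCompact E := by
    refine isCompact_Icc.of_isClosed_subset ?_ (sep_subset _ _)
    have hcd : ContinuousOn (fun t => dist (c t) (d t)) (Icc 0 τ) :=
      continuous_dist.comp_continuousOn
        ((hc.continuousOn.mono hcx).prodMk (hd.continuousOn.mono hdy))
    exact hcd.preimage_isClosed_of_isClosed isClosed_Icc isClosed_singleton
  have hEne : E.Nonempty := ⟨0, ⟨le_rfl, hτ⟩, by simp [hc.2.1, hd.2.1]⟩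
  -- `c m` is the branch point: the last common point up to `τ`.
  obtain ⟨m, ⟨⟨hm0, hmτ⟩, hm⟩, hmax⟩ := hEc.exists_isGreatest hEne
  have hcdm : c m = d m := dist_eq_zero.1 hm
  have hmτ' : m < τ := lt_of_le_of_ne hmτ fun h => hne (h ▸ hcdm)
  have hafter : ∀ t, m < t → t ≤ dist p x → t ≤ dist p y → c t ≠ d t := by
    intro t hmt htx hty h
    have hEt : min t τ ∈ E := by
      refine ⟨⟨le_min (hm0.trans hmt.le) hτ, min_le_right _ _⟩, ?_⟩
      rw [hT.eq_of_eq hc hd (hm0.trans hmt.le) htx hty h (le_min (hm0.trans hmt.le) hτ)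
        (min_le_left _ _), dist_self]
      rfl
    exact (hmax hEt).not_gt (lt_min hmt hmτ')
  obtain ⟨a, ha⟩ : ∃ a, a = dist p x - m := ⟨_, rfl⟩
  obtain ⟨b, hb⟩ : ∃ b, b = dist p y - m := ⟨_, rfl⟩
  have ha0 : 0 < a := by linarith
  have hb0 : 0 < b := by linarith
  -- Back along `c` to the branch point, then out along `d`. This is an arc, hence the geodesic from
  -- `x` to `y`, so distances through the branch point add up.
  let f : ℝ → T := fun t => if t ≤ a then c (dist p x - t) else d (t - a + m)
  have hfa : f a = c m := by
    simp only [f, if_pos le_rfl]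
    rw [ha, sub_sub_cancel]
  have hf0 : f 0 = x := by
    simp only [f, if_pos ha0.le, sub_zero, hc.2.2]
  have hfL : f (a + b) = y := by
    have : ¬ a + b ≤ a := by linarith
    simp only [f, if_neg this]
    rw [show a + b - a + m = dist p y by rw [hb]; ring, hd.2.2]
  have hcont : ContinuousOn f (Icc 0 (a + b)) := by
    have hun : Icc 0 (a + b) = Icc 0 a ∪ Icc a (a + b) :=
      (Icc_union_Icc_eq_Icc ha0.le (by linarith)).symm
    rw [hun]
    refine ContinuousOn.union_of_isClosed ?_ ?_ isClosed_Icc isClosed_Icc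
    · refine ContinuousOn.congr (f := fun t => c (dist p x - t)) ?_ fun t ht => if_pos ht.2
      refine hc.continuousOn.comp (by fun_prop) fun t ht => ?_
      exact ⟨by linarith [ht.2], by linarith [ht.1]⟩
    · refine ContinuousOn.congr (f := fun t => d (t - a + m)) ?_ fun t ht => ?_
      · refine hd.continuousOn.comp (by fun_prop) fun t ht => ?_
        exact ⟨by linarith [ht.1], by linarith [ht.2]⟩
      · rcases ht.1.eq_or_lt with h | h
        · rw [← h, hfa, hcdm]
          simp only [sub_self, zero_add]
        · exact if_neg h.not_ge
  have hcross : ∀ s t, 0 ≤ s → s ≤ a → a < t → t ≤ a + b → f s ≠ f t := by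
    intro s t hs hsa hat htb h
    simp only [f, if_pos hsa, if_neg hat.not_ge] at h
    have h1 := hc.dist_left (t := dist p x - s) ⟨by linarith, by linarith⟩
    have h2 := hd.dist_left (t := t - a + m) ⟨by linarith, by linarith⟩
    rw [h, h2] at h1
    rw [← h1] at h
    exact hafter (t - a + m) (by linarith) (by linarith) (by linarith) h
  have hinj : InjOn f (Icc 0 (a + b)) := by
    intro s hs t ht hst
    rcases le_or_gt s a with hsa | hsa <;> rcases le_or_gt t a with hta | hta
    · simp only [f, if_pos hsa, if_pos hta] at hst
      have := hc.injOn (x₁ := dist p x - s) (x₂ := dist p x - t)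
        ⟨by linarith, by linarith [hs.1]⟩ ⟨by linarith, by linarith [ht.1]⟩ hst
      linarith
    · exact absurd hst (hcross s t hs.1 hsa hta ht.2)
    · exact absurd hst.symm (hcross t s ht.1 hta hsa hs.2)
    · simp only [f, if_neg hsa.not_ge, if_neg hta.not_ge] at hst
      have := hd.injOn (x₁ := s - a + m) (x₂ := t - a + m)
        ⟨by linarith, by linarith [hs.2]⟩ ⟨by linarith, by linarith [ht.2]⟩ hst
      linarith
  have harc := isArcJoining_image_Icc (by linarith : 0 < a + b) hcont hinj
  rw [hf0, hfL] at harc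
  have hxy : x ≠ y := by
    intro h
    have := hinj (x₁ := 0) (x₂ := a + b) ⟨le_rfl, by linarith⟩ ⟨by linarith, le_rfl⟩
      (by rw [hf0, hfL, h])
    linarith
  obtain ⟨S, -, hS, g, hg1, hg2, hg3, hgS⟩ := hT x y hxy
  have hmS : c m ∈ S := by
    rw [← hS _ harc, ← hfa]
    exact mem_image_of_mem f ⟨ha0.le, by linarith⟩
  have hg : IsGeodesicPath g x y := ⟨hg1, hg2, hg3⟩
  rw [← hgS] at hmS
  obtain ⟨t, ht, htm⟩ := hmS
  have h1 := hg.dist_left ht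
  have h2 := hg.dist_right ht
  have h3 := hc.dist_right (t := m) ⟨hm0, by linarith⟩
  have h4 := hd.dist_right (t := m) ⟨hm0, by linarith⟩
  rw [htm, dist_comm, h3] at h1
  rw [htm, hcdm, h4] at h2
  linarith

/-! ### Labelings of trees and of their products -/

/-- An `ℝ`-tree carries, at each scale, `n + 1` partially defined labelings whose fibers are bounded
and separated, such that each point lies in the domain of all but one of them. -/
theorem exists_labelings (hT : IsRTree T) (p : T) (n : ℕ) {δ : ℝ} (hδ : 0 < δ) :
    ∃ (D : Fin (n + 1) → Set T) (l : Fin (n + 1) → T → ℤ × T),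
      (∀ x, ∃ k₀, ∀ k, k ≠ k₀ → x ∈ D k) ∧
      (∀ k, ∀ x ∈ D k, ∀ y ∈ D k, l k x = l k y → dist x y ≤ (2 * n + 1) * δ) ∧
      ∀ k, ∀ x ∈ D k, ∀ y ∈ D k, l k x ≠ l k y → δ ≤ dist x y := by
  choose c hc using fun x => hT.exists_isGeodesicPath p x
  let q : T → ℤ := fun x => ⌊dist p x / δ⌋
  have hq : ∀ x, q x * δ ≤ dist p x ∧ dist p x < (q x + 1) * δ := fun x =>
    ⟨(le_div_iff₀ hδ).1 (Int.floor_le _), (div_lt_iff₀ hδ).1 (Int.lt_floor_add_one _)⟩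
  -- Labeling `k` discards the annuli `q ≡ k` mod `n + 1`. Block `i` consists of the `n` annuli
  -- starting at index `a k i`, and `τ` is a radius `δ / 2` below it, truncated at the root. The
  -- half step yields both the separation `2 * (δ / 2)` and the diameter `2 * (n * δ + δ / 2)`.
  let j : Fin (n + 1) → T → ℤ := fun k x => (q x - k + n) / (n + 1)
  let a : Fin (n + 1) → ℤ → ℤ := fun k i => (n + 1) * i + k - n
  let τ : Fin (n + 1) → ℤ → ℝ := fun k i => max 0 (a k i * δ - δ / 2)
  let D : Fin (n + 1) → Set T := fun k => {x | (q x - k + n) % (n + 1) ≠ n}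
  have hn : (0 : ℤ) < n + 1 := by positivity
  have hD : ∀ k, ∀ x ∈ D k, a k (j k x) ≤ q x ∧ q x + 1 ≤ a k (j k x) + n := by
    intro k x hx
    have hx' : (q x - k + n) % (n + 1) ≠ n := hx
    have h1 := Int.mul_ediv_add_emod (q x - k + n) (n + 1)
    have h2 := Int.emod_nonneg (q x - k + n) hn.ne'
    have h3 := Int.emod_lt_of_pos (q x - k + n) hn
    simp only [a, j]
    constructor <;> omega
  have hDr : ∀ k, ∀ x ∈ D k, a k (j k x) * δ ≤ dist p x ∧
      dist p x ≤ a k (j k x) * δ + n * δ := by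
    intro k x hx
    obtain ⟨h1, h2⟩ := hD k x hx
    have h1' : (a k (j k x) : ℝ) ≤ q x := by exact_mod_cast h1
    have h2' : (q x + 1 : ℝ) ≤ a k (j k x) + n := by exact_mod_cast h2
    refine ⟨(mul_le_mul_of_nonneg_right h1' hδ.le).trans (hq x).1, ?_⟩
    rw [← add_mul]
    exact (hq x).2.le.trans (mul_le_mul_of_nonneg_right h2' hδ.le)
  have hτ : ∀ k, ∀ x ∈ D k, τ k (j k x) ≤ dist p x := fun k x hx =>
    max_le dist_nonneg (by linarith [(hDr k x hx).1])
  have hlevel : ∀ k, ∀ x ∈ D k, ∀ y ∈ D k, j k x < j k y → δ ≤ dist x y := by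
    intro k x hx y hy hlt
    have h1 : a k (j k x) + n + 1 ≤ a k (j k y) := by
      simp only [a]
      nlinarith
    have h1' : (a k (j k x) + n + 1 : ℝ) * δ ≤ a k (j k y) * δ :=
      mul_le_mul_of_nonneg_right (by exact_mod_cast h1) hδ.le
    have h2 := (hDr k x hx).2
    have h3 := (hDr k y hy).1
    have h4 := dist_triangle p x y
    linarith
  refine ⟨D, fun k x => (j k x, c x (τ k (j k x))), fun x => ?_, ?_, ?_⟩
  · have h2 := Int.emod_nonneg (q x) hn.ne'
    have h3 := Int.emod_lt_of_pos (q x) hn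
    refine ⟨⟨(q x % (n + 1)).toNat, by omega⟩, fun k hk hx => hk (Fin.ext ?_)⟩
    have h4 := Int.mul_ediv_add_emod (q x - k + n) (n + 1)
    have h5 : q x % (n + 1) = k := by
      rw [show q x = k + (n + 1) * ((q x - k + n) / (n + 1)) by linarith,
        Int.add_mul_emod_self_left, Int.emod_eq_of_lt (by positivity) (by exact_mod_cast k.2)]
    simp [h5]
  · intro k x hx y hy hxy
    simp only [Prod.mk.injEq] at hxy
    obtain ⟨hj, hcc⟩ := hxy
    have h1 := (hc x).dist_right (t := τ k (j k x)) ⟨le_max_left _ _, hτ k x hx⟩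
    have h2 := (hc y).dist_right (t := τ k (j k y)) ⟨le_max_left _ _, hτ k y hy⟩
    have h3 := dist_triangle_left x y (c x (τ k (j k x)))
    rw [h1, hcc, h2] at h3
    have h4 := (hDr k x hx).2
    have h5 := (hDr k y hy).2
    have h6 : a k (j k x) * δ - δ / 2 ≤ τ k (j k x) := le_max_right _ _
    rw [← hj] at h3 h5
    linarith
  · intro k x hx y hy hxy
    rcases lt_trichotomy (j k x) (j k y) with hlt | heq | hgt
    · exact hlevel k x hx y hy hlt
    · have hcc : c x (τ k (j k x)) ≠ c y (τ k (j k x)) := by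
        intro h
        refine hxy (Prod.ext heq ?_)
        simp only
        rw [h, heq]
      have hτy := hτ k y hy
      have h5 := (hDr k y hy).1
      rw [← heq] at hτy h5
      have h1 := hT.le_dist_of_ne (hc x) (hc y) (le_max_left _ _) (hτ k x hx) hτy hcc
      have h4 := (hDr k x hx).1
      rcases le_total 0 (a k (j k x) * δ - δ / 2) with h0 | h0
      · have h6 : τ k (j k x) = a k (j k x) * δ - δ / 2 := max_eq_right h0
        have h7 : (dist p x - τ k (j k x)) + (dist p y - τ k (j k x)) ≤ dist x y := h1
        rw [h6] at h7
        linarith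
      -- When `τ` is truncated, both geodesics are at the root, so the labels cannot differ.
      · have h6 : τ k (j k x) = 0 := max_eq_left h0
        rw [h6, (hc x).2.1, (hc y).2.1] at hcc
        exact absurd rfl hcc
    · rw [dist_comm]
      exact hlevel k y hy x hx hgt

end IsRTree

/-- Spaces that embed weakly into a product of `n` trees have Nagata dimension at most `n`. -/
theorem WeaklyEmbeds.nagataDimLE {X : Type u} [MetricSpace X] {n : ℕ} {C : ℝ≥0}
    {T : Fin n → Type v} [∀ i, MetricSpace (T i)] (hT : ∀ i, IsRTree (T i))
    (h : WeaklyEmbeds X (∀ i, T i) C) : NagataDimLE X n (C * (2 * n + 2)) := by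
  obtain ⟨φ, hφ⟩ := h
  rcases isEmpty_or_nonempty X with hX | ⟨⟨x₀⟩⟩
  · exact fun s _ => ⟨∅, by simp [eq_empty_of_isEmpty], by simp, by simp⟩
  refine nagataDimLE_of_labelings (L := ∀ i, ℤ × T i) fun s hs => ?_
  -- With `δ = σ * s`, equal labels bound the image distance by `(2 * n + 1) * σ * s`, strictly
  -- below the threshold `t * σ` for `t = (2 * n + 2) * s`.
  obtain ⟨σ, hσ, hupper, hlower⟩ := hφ ((2 * n + 2) * s) (by positivity)
  choose D l hcov hbdd hsep using fun i =>
    -- The root is arbitrary; `φ 0 x₀` merely supplies a point.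
    (hT i).exists_labelings (φ 0 x₀ i) n (mul_pos hσ hs)
  let f : X → ∀ i, T i := φ ((2 * n + 2) * s)
  refine ⟨fun k => {x | ∀ i, f x i ∈ D i k}, fun k x i => l i k (f x i), fun x => ?_, ?_, ?_⟩
  · choose k₀ hk₀ using fun i => hcov i (f x i)
    obtain ⟨k, hk⟩ : ∃ k, k ∉ range k₀ := by
      by_contra! hsurj
      have := Fintype.card_le_of_surjective k₀ hsurj
      simp at this
    exact ⟨k, fun i => hk₀ i k fun h => hk ⟨i, h.symm⟩⟩
  · intro k x hx y hy hxy
    by_contra! hlt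
    have h1 := hlower x y (by push_cast at hlt; linarith)
    have h2 : dist (f x) (f y) ≤ (2 * n + 1) * (σ * s) :=
      (dist_pi_le_iff (by positivity)).2 fun i =>
        hbdd i k _ (hx i) _ (hy i) (congrFun hxy i)
    have h3 : (0 : ℝ) < σ * s := mul_pos hσ hs
    simp only [f] at h2
    linarith
  · intro k x hx y hy hxy
    obtain ⟨i, hi⟩ := Function.ne_iff.1 hxy
    have h1 := hsep i k _ (hx i) _ (hy i) hi
    have h2 := (h1.trans (dist_le_pi_dist (f x) (f y) i)).trans (hupper x y)
    exact le_of_mul_le_mul_left h2 hσ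

/-! ### `ℝ`-stars are `ℝ`-trees -/

/-- A geodesic space is an `ℝ`-tree if the points of its geodesics are cut points, as witnessed by
continuous functions. -/
theorem isRTree_of_cut_points {T : Type*} [MetricSpace T]
    (h : ∀ x y : T, x ≠ y → ∃ c, IsGeodesicPath c x y ∧ ∀ t ∈ Icc 0 (dist x y), ∃ g : T → ℝ,
      Continuous g ∧ g (c t) ∈ uIcc (g x) (g y) ∧ ∀ z, g z = g (c t) → z = c t) :
    IsRTree T := by
  intro x y hxy
  obtain ⟨c, hc, hcut⟩ := h x y hxy
  have hS := isArcJoining_image_Icc (dist_pos.2 hxy) hc.continuousOn hc.injOn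
  rw [hc.2.1, hc.2.2] at hS
  refine ⟨c '' Icc 0 (dist x y), hS, ?_, c, hc.1, hc.2.1, hc.2.2, rfl⟩
  rintro _ ⟨f, hf, hinj, hf0, hf1, rfl⟩
  -- By the intermediate value theorem every arc from `x` to `y` passes through each `c t`.
  have hsub : c '' Icc 0 (dist x y) ⊆ range f := by
    rintro _ ⟨t, ht, rfl⟩
    obtain ⟨g, hg, hmem, hz⟩ := hcut t ht
    obtain ⟨s, hs⟩ : g (c t) ∈ range (g ∘ f) :=
      (isPreconnected_range (hg.comp hf)).ordConnected.uIcc_subset ⟨0, by simp [hf0]⟩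
        ⟨1, by simp [hf1]⟩ hmem
    exact ⟨s, hz _ hs⟩
  refine Subset.antisymm ?_ hsub
  -- Conversely, the parameters mapped into the geodesic form a connected set containing `0` and
  -- `1`.
  have hpre : IsPreconnected (f ⁻¹' (c '' Icc 0 (dist x y))) :=
    (isPreconnected_Icc.image c hc.continuousOn).preimage_of_isClosedMap hinj
      hf.isClosedMap hsub
  rintro _ ⟨s, rfl⟩
  exact hpre.ordConnected.out (x := 0) (y := 1)
    ⟨0, ⟨le_rfl, dist_nonneg⟩, by rw [hf0, hc.2.1]⟩
    ⟨_, ⟨dist_nonneg, le_rfl⟩, by rw [hf1, hc.2.2]⟩ ⟨unitInterval.nonneg', unitInterval.le_one'⟩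

namespace RStar

variable {A : Type*}

/-- The distance to the base point, with negative sign off the branch `a`. -/
noncomputable def signedHeight (a : A) (x : RStar A) : ℝ := 2 * x.1 a - dist x (mk a 0)

theorem continuous_signedHeight (a : A) : Continuous (signedHeight a) := by
  have h : LipschitzWith 1 fun x : RStar A => x.1 a :=
    LipschitzWith.of_dist_le_mul fun x y => by
      rw [NNReal.coe_one, one_mul]
      exact abs_apply_sub_le x y a
  exact (h.continuous.const_mul 2).sub (continuous_id.dist continuous_const)

theorem signedHeight_mk_self (a : A) {r : ℝ} (hr : 0 ≤ r) : signedHeight a (mk a r) = r := by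
  rw [signedHeight, mk_apply_self, dist_mk_self, max_eq_left hr, max_self, sub_zero,
    abs_of_nonneg hr]
  ring

theorem signedHeight_mk_of_ne {a b : A} (h : b ≠ a) {r : ℝ} (hr : 0 ≤ r) :
    signedHeight a (mk b r) = -r := by
  rw [signedHeight, mk_apply_of_ne h.symm, dist_mk_of_ne h, max_eq_left hr, max_self]
  ring

/-- Signed height is injective on branch `a` and negative off it, so each of its nonnegative values
is taken only once. -/
theorem eq_mk_of_signedHeight_eq {a : A} {r : ℝ} (hr : 0 ≤ r) {x : RStar A}
    (h : signedHeight a x = signedHeight a (mk a r)) : x = mk a r := by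
  have : Nonempty A := ⟨a⟩
  obtain ⟨b, s, hs, rfl⟩ := exists_eq_mk x
  rw [signedHeight_mk_self a hr] at h
  by_cases hba : b = a
  · subst hba
    rw [← h, signedHeight_mk_self b hs]
  · rw [signedHeight_mk_of_ne hba hs] at h
    exact mk_of_nonpos b a (by linarith) (by linarith)

theorem isRTree (A : Type*) : IsRTree (RStar A) := by
  refine isRTree_of_cut_points fun x y hxy => ?_
  have : Nonempty A := by
    by_contra hA
    rw [not_nonempty_iff] at hA
    exact hxy (Subtype.ext (lp.ext (funext fun a => isEmptyElim a)))
  obtain ⟨a, r, hr, rfl⟩ := exists_eq_mk x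
  obtain ⟨b, s, hs, rfl⟩ := exists_eq_mk y
  by_cases hab : a = b
  · subst hab
    have hd : dist (mk a r) (mk a s) = |r - s| := by
      rw [dist_mk_self, max_eq_left hr, max_eq_left hs]
    -- `ε` is the direction of travel along the common branch.
    obtain ⟨ε, hε, hrs⟩ : ∃ ε : ℝ, (ε = 1 ∨ ε = -1) ∧ r + ε * |r - s| = s := by
      rcases le_total r s with h | h
      · exact ⟨1, Or.inl rfl, by rw [abs_of_nonpos (by linarith)]; ring⟩
      · exact ⟨-1, Or.inr rfl, by rw [abs_of_nonneg (by linarith)]; ring⟩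
    have hpos : ∀ t ∈ Icc 0 |r - s|, 0 ≤ r + ε * t := by
      intro t ht
      rcases hε with rfl | rfl <;> linarith [ht.1, ht.2]
    refine ⟨fun t => mk a (r + ε * t), ⟨?_, by simp, by rw [hd]; simp only [hrs]⟩, ?_⟩
    · rw [hd]
      intro t ht t' ht'
      have hε' : |ε| = 1 := by rcases hε with rfl | rfl <;> simp
      rw [dist_mk_self, max_eq_left (hpos t ht), max_eq_left (hpos t' ht'), add_sub_add_left_eq_sub,
        ← mul_sub, abs_mul, hε', one_mul]
    · rw [hd]
      intro t ht
      refine ⟨signedHeight a, continuous_signedHeight a, ?_,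
        fun z hz => eq_mk_of_signedHeight_eq (hpos t ht) hz⟩
      rw [signedHeight_mk_self a hr, signedHeight_mk_self a hs,
        signedHeight_mk_self a (hpos t ht), mem_uIcc]
      rcases hε with rfl | rfl
      · left
        constructor <;> linarith [ht.1, ht.2]
      · right
        constructor <;> linarith [ht.1, ht.2]
  · have hd : dist (mk a r) (mk b s) = r + s := by
      rw [dist_mk_of_ne hab, max_eq_left hr, max_eq_left hs]
    obtain ⟨c, hc⟩ : ∃ c : ℝ → RStar A, c = fun t => if t ≤ r then mk a (r - t) else mk b (t - r) :=
      ⟨_, rfl⟩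
    have hca : ∀ t, t ≤ r → c t = mk a (r - t) := fun t ht => by rw [hc]; exact if_pos ht
    have hcb : ∀ t, r ≤ t → c t = mk b (t - r) := fun t ht => by
      rcases ht.eq_or_lt with rfl | ht
      · rw [hca r le_rfl]
        exact mk_of_nonpos _ _ (by simp) (by simp)
      · rw [hc]
        exact if_neg ht.not_ge
    have hmix : ∀ t t', t ≤ r → r ≤ t' → dist (c t) (c t') = |t - t'| := by
      intro t t' ht ht'
      rw [hca t ht, hcb t' ht', dist_mk_of_ne hab, max_eq_left (by linarith),
        max_eq_left (by linarith), abs_of_nonpos (by linarith)]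
      ring
    refine ⟨c, ⟨fun t _ t' _ => ?_, by rw [hca 0 hr, sub_zero], ?_⟩, ?_⟩
    · rcases le_total t r with h | h <;> rcases le_total t' r with h' | h'
      · rw [hca t h, hca t' h', dist_mk_self, max_eq_left (by linarith),
          max_eq_left (by linarith), abs_sub_comm]
        congr 1
        ring
      · exact hmix t t' h h'
      · rw [dist_comm, abs_sub_comm]
        exact hmix t' t h' h
      · rw [hcb t h, hcb t' h', dist_mk_self, max_eq_left (by linarith),
          max_eq_left (by linarith)]
        congr 1
        ring
    · rw [hd, hcb _ (by linarith), add_sub_cancel_left]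
    · rw [hd]
      intro t ht
      rcases le_total t r with h | h
      · have h0 : 0 ≤ r - t := by linarith
        refine ⟨signedHeight a, continuous_signedHeight a, ?_, fun z hz => ?_⟩
        · rw [hca t h, signedHeight_mk_self a hr, signedHeight_mk_of_ne (Ne.symm hab) hs,
            signedHeight_mk_self a h0, mem_uIcc]
          right
          constructor <;> linarith [ht.1, ht.2]
        · rw [hca t h] at hz ⊢
          exact eq_mk_of_signedHeight_eq h0 hz
      · have h0 : 0 ≤ t - r := by linarith
        refine ⟨signedHeight b, continuous_signedHeight b, ?_, fun z hz => ?_⟩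
        · rw [hcb t h, signedHeight_mk_self b hs, signedHeight_mk_of_ne hab hr,
            signedHeight_mk_self b h0, mem_uIcc]
          left
          constructor <;> linarith [ht.1, ht.2]
        · rw [hcb t h] at hz ⊢
          exact eq_mk_of_signedHeight_eq h0 hz

end RStar

theorem theorem2p3 :
    (∀ (X : Type u) [MetricSpace X],
      HasFiniteNagataDim X ↔
        ∃ (m : ℕ) (T : Fin m → Type u) (_ : ∀ i, MetricSpace (T i)) (C : ℝ≥0),
          (∀ i, IsRTree (T i)) ∧ WeaklyEmbeds X (∀ i, T i) C) ∧
    (∀ (n : ℕ) (γ : ℝ≥0), ∃ C : ℝ≥0, ∀ (X : Type u) [MetricSpace X],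
      NagataDimLE X n γ →
        ∃ A : Fin (n + 1) → Type u, WeaklyEmbeds X (∀ i, RStar (A i)) C) ∧
    (∀ (n : ℕ) (C : ℝ≥0), ∃ γ : ℝ≥0, ∀ (X : Type u) [MetricSpace X]
      (T : Fin n → Type v) [∀ i, MetricSpace (T i)],
      (∀ i, IsRTree (T i)) → WeaklyEmbeds X (∀ i, T i) C → NagataDimLE X n γ) := by
  refine ⟨fun X _ => ⟨?_, ?_⟩, fun n γ => ⟨_, fun X _ h => ⟨fun _ => Set X, h.weaklyEmbeds⟩⟩,
    fun n C => ⟨_, fun X _ T _ hT h => h.nagataDimLE hT⟩⟩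
  · rintro ⟨n, γ, h⟩
    exact ⟨n + 1, fun _ => RStar (Set X), fun _ => inferInstance, _,
      fun _ => RStar.isRTree (Set X), h.weaklyEmbeds⟩
  · rintro ⟨m, T, _, C, hT, h⟩
    exact ⟨m, _, h.nagataDimLE hT⟩
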